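/- Let $A\in\mathbb{R}^{n\times n}$ have no eigenvalue with positive real part, let $\mathcal{G}$ be a digraph on the agents $0,1,\dots,N$, where $0$ is the leader and $1,\dots,N$ are the followers, and let $a_{ij}=1$ if agent $i$ receives information from agent $j$ (there is an edge from $j$ to $i$) and $a_{ij}=0$ otherwise. Assume that $\mathcal{G}$ contains a directed spanning tree rooted at the leader, i.e. there is a directed path from $0$ to every agent. For each edge from $j$ to $i$ let $\tau_{ij}:[0,\infty)\to[0,\bar\tau]$ be the (known, heterogeneous, time-varying, bounded) communication delay from $j$ to $i$, and let $\epsilon>0$ be arbitrary. Let the leader satisfy $\dot x_0(t)=Ax_0(t)$ for $t\in\mathbb{R}$, and let the observers $\xi_i(t)\in\mathbb{R}^n$, $i=1,\dots,N$, satisfy $\xi_i(t)=0$ for $t\le 0$ and $$\dot\xi_i(t)=A\xi_i(t)+\epsilon\sum_{j=1,\,j\ne i}^{N}a_{ij}\bigl[e^{A\tau_{ij}(t)}\xi_j(t-\tau_{ij}(t))-\xi_i(t)\bigr]+\epsilon a_{i0}\bigl[e^{A\tau_{i0}(t)}x_0(t-\tau_{i0}(t))-\xi_i(t)\bigr],\qquad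 t\ge 0,$$ in the Carathéodory sense ($\xi_i$ is continuous and is the integral of the right-hand side). Then every observer error $\xi_i-x_0$ tends to zero exponentially: there are constants $C,\beta>0$, independent of the initial state $x_0(0)$, such that $$\|\xi_i(t)-x_0(t)\|\le C e^{-\beta t}\|x_0(0)\|\qquad\text{for all } t\ge 0,\ i=1,\dots,N.$$ -/

import Mathlib

open scoped Matrix

/-- In the communication digraph on the agents `0, 1, …, N` (with `0` the leader), `G.Adj j i` means
that agent `i` receives information from agent `j`. The weight `a_{ij}` is then `1`, and it is `0`
if there is no such edge. -/
noncomputable def weight {N : ℕ} (G : Digraph (Fin (N + 1))) (i j : Fin (N + 1)) : ℝ :=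
  open Classical in if G.Adj j i then 1 else 0

/-- `G` contains a directed spanning tree with root `r`: there is a directed path from `r` to
every node. -/
def HasSpanningTreeRootedAt {N : ℕ} (G : Digraph (Fin (N + 1))) (r : Fin (N + 1)) : Prop :=
  ∀ v, Relation.ReflTransGen G.Adj r v

/-- No (complex) eigenvalue of the real matrix `A` has positive real part. -/
def NoEigenvalueWithPosRe {n : ℕ} (A : Matrix (Fin n) (Fin n) ℝ) : Prop :=
  ∀ μ : ℂ, Module.End.HasEigenvalue (Matrix.toLin' (A.map ((↑) : ℝ → ℂ))) μ → μ.re ≤ 0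

/-- The leader dynamics `x₀' = A x₀`. -/
def IsLeaderTrajectory {n : ℕ} (A : Matrix (Fin n) (Fin n) ℝ) (x₀ : ℝ → Fin n → ℝ) : Prop :=
  ∀ t, HasDerivAt x₀ (A *ᵥ x₀ t) t

/-- The right-hand side of the observer of follower `i` at time `t`. Follower `i : Fin N` is the
agent `i.succ`; `τ i j` is the communication delay from agent `j` to agent `i`. -/
noncomputable def observerField {N n : ℕ} (A : Matrix (Fin n) (Fin n) ℝ)
    (G : Digraph (Fin (N + 1))) (ε : ℝ) (τ : Fin (N + 1) → Fin (N + 1) → ℝ → ℝ)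
    (x₀ : ℝ → Fin n → ℝ) (ξ : Fin N → ℝ → Fin n → ℝ) (i : Fin N) (t : ℝ) : Fin n → ℝ :=
  A *ᵥ ξ i t
    + ε • ∑ j ∈ Finset.univ.erase i, weight G i.succ j.succ •
        (NormedSpace.exp (τ i.succ j.succ t • A) *ᵥ ξ j (t - τ i.succ j.succ t) - ξ i t)
    + (ε * weight G i.succ 0) •
        (NormedSpace.exp (τ i.succ 0 t • A) *ᵥ x₀ (t - τ i.succ 0 t) - ξ i t)

/-- `ξ` is a (Carathéodory) solution of the observer equations `ξ_i' = observerField … i` on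
`[0, ∞)` with `ξ_i(t) = 0` for `t ≤ 0`: each `ξ_i` is continuous and is the integral of the
right-hand side, i.e. it is locally absolutely continuous and the equation holds for almost every
`t ≥ 0`. Classical solutions are included. -/
structure IsObserverTrajectory {N n : ℕ} (A : Matrix (Fin n) (Fin n) ℝ)
    (G : Digraph (Fin (N + 1))) (ε : ℝ) (τ : Fin (N + 1) → Fin (N + 1) → ℝ → ℝ)
    (x₀ : ℝ → Fin n → ℝ) (ξ : Fin N → ℝ → Fin n → ℝ) : Prop where
  continuous : ∀ i, Continuous (ξ i)
  eq_zero : ∀ i, ∀ t ≤ 0, ξ i t = 0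
  integrable : ∀ i, ∀ t ≥ 0,
    IntervalIntegrable (observerField A G ε τ x₀ ξ i) MeasureTheory.volume 0 t
  eq_integral : ∀ i, ∀ t ≥ 0, ξ i t = ∫ s in (0 : ℝ)..t, observerField A G ε τ x₀ ξ i s

/-! Since `x₀ t = exp (r • A) *ᵥ x₀ (t - r)`, compensating a delayed signal by the exponential
recovers the current leader state exactly. In the moving coordinates `z_i(t) = e^{-At} (ξ_i(t) -
x₀(t))` the matrix `A` therefore disappears, leaving `z_i' = -ε d_i z_i + ε ∑_{j ≠ i} a_ij z_j(t -
τ_ij)`, where `d_i` is the in-degree of follower `i`. The spanning tree yields positive weights `v`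
with `∑_{j ≠ i} a_ij v_j < d_i v_i` (`exists_sum_weight_mul_lt`). The strict inequality leaves room
for a rate `β` that absorbs the factor `e^{β τbar}` caused by the delays (`exists_decay_rate`), and
a first-crossing argument gives `‖z_i(t)‖ ≤ 2 ‖x₀ 0‖ v_i e^{-βt}`
(`norm_le_mul_exp_of_delay_bound`). Returning to `ξ_i - x₀` costs a factor `e^{At}`, which by the
spectral hypothesis is `O(e^{βt/2})`, so the rate `β/2` survives. -/

/-! ### Subexponential growth of the matrix exponential. -/

section MatrixExponential

open NormedSpace
open scoped Matrix.Norms.Operator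

theorem Matrix.hasDerivAt_exp_smul {m 𝕂 : Type*} [Fintype m] [DecidableEq m] [RCLike 𝕂]
    (M : Matrix m m 𝕂) (t : ℝ) :
    HasDerivAt (fun s : ℝ => exp (s • M)) (exp (t • M) * M) t :=
  hasDerivAt_exp_smul_const M t

theorem HasDerivAt.matrix_entry {m 𝕂 : Type*} [Fintype m] [DecidableEq m] [RCLike 𝕂]
    {V : ℝ → Matrix m m 𝕂} {V' : Matrix m m 𝕂} {t : ℝ} (h : HasDerivAt V V' t) (k l : m) :
    HasDerivAt (fun s => V s k l) (V' k l) t :=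
  ((LinearMap.toContinuousLinearMap (Matrix.entryLinearMap ℝ 𝕂 k l)).hasFDerivAt.comp_hasDerivAt
    t h :)

theorem Matrix.hasDerivAt_exp_smul_mulVec {m 𝕂 : Type*} [Fintype m] [DecidableEq m] [RCLike 𝕂]
    (M : Matrix m m 𝕂) (v : m → 𝕂) (t : ℝ) :
    HasDerivAt (fun s : ℝ => exp (s • M) *ᵥ v) (exp (t • M) *ᵥ (M *ᵥ v)) t := by
  rw [Matrix.mulVec_mulVec]
  have h := M.hasDerivAt_exp_smul t
  rw [hasDerivAt_pi]
  intro k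
  simp only [Matrix.mulVec, dotProduct]
  exact HasDerivAt.fun_sum fun l _ => (h.matrix_entry k l).mul_const (v l)

theorem Matrix.exp_add_smul {m 𝕂 : Type*} [Fintype m] [DecidableEq m] [RCLike 𝕂]
    (M : Matrix m m 𝕂) (s t : ℝ) : exp ((s + t) • M) = exp (s • M) * exp (t • M) := by
  rw [add_smul]
  exact Matrix.exp_add_of_commute _ _ (((Commute.refl M).smul_left s).smul_right t)

theorem Matrix.exp_smul_mulVec_exp_smul_mulVec {m 𝕂 : Type*} [Fintype m] [DecidableEq m]
    [RCLike 𝕂] (M : Matrix m m 𝕂) (s t : ℝ) (v : m → 𝕂) :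
    exp (s • M) *ᵥ (exp (t • M) *ᵥ v) = exp ((s + t) • M) *ᵥ v := by
  rw [M.exp_add_smul, Matrix.mulVec_mulVec]

theorem Module.End.hasEigenvalue_of_maxGenEigenspace_ne_bot {R M : Type*} [CommRing R]
    [AddCommGroup M] [Module R M] {f : Module.End R M} {μ : R}
    (h : f.maxGenEigenspace μ ≠ ⊥) : f.HasEigenvalue μ :=
  HasUnifEigenvalue.lt (k := ⊤) zero_lt_one h

/-- Along a generalized eigenvector for an eigenvalue in the closed left half plane, the matrix
exponential grows slower than any exponential. -/
theorem Matrix.exists_norm_exp_smul_mulVec_le_of_pow_sub_apply_eq_zero {m : Type*} [Fintype m]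
    [DecidableEq m] (M : Matrix m m ℂ) {μ : ℂ} (hμ : μ.re ≤ 0) {γ : ℝ} (hγ : 0 < γ) (k : ℕ)
    (v : m → ℂ) (hv : ((Matrix.toLin' M - algebraMap ℂ (Module.End ℂ (m → ℂ)) μ) ^ k) v = 0) :
    ∃ K : ℝ, ∀ t : ℝ, 0 ≤ t → ‖exp (t • M) *ᵥ v‖ ≤ K * Real.exp (γ * t) := by
  induction k generalizing v with
  | zero =>
    have : v = 0 := by simpa using hv
    exact ⟨0, fun t _ => by simp [this]⟩
  | succ k ih =>
    -- The vector `(M - μ) v` is killed by `(M - μ) ^ k`.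
    obtain ⟨K, hK⟩ := ih (M *ᵥ v - μ • v) (by
      rw [pow_succ] at hv
      simpa [Module.algebraMap_end_apply] using hv)
    have hK0 : 0 ≤ K := by simpa using (norm_nonneg _).trans (hK 0 le_rfl)
    set c : ℝ := γ - μ.re with hc
    have hc0 : 0 < c := by linarith
    refine ⟨‖v‖ + K / c, fun t ht => ?_⟩
    have hderiv : ∀ s : ℝ, HasDerivAt (fun s : ℝ => Complex.exp (-μ * s) • (exp (s • M) *ᵥ v))
        (Complex.exp (-μ * s) • (exp (s • M) *ᵥ (M *ᵥ v - μ • v))) s := by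
      intro s
      have h1 : HasDerivAt (fun s : ℝ => Complex.exp (-μ * s)) (Complex.exp (-μ * s) * -μ) s := by
        have := ((Complex.ofRealCLM.hasDerivAt (x := s)).const_mul (-μ)).cexp
        simpa using this
      have h2 := h1.smul (M.hasDerivAt_exp_smul_mulVec v s)
      refine h2.congr_deriv ?_
      rw [Matrix.mulVec_sub, Matrix.mulVec_smul, smul_sub, smul_smul]
      module
    have hnorm : ∀ s : ℝ, ‖Complex.exp (-μ * s)‖ = Real.exp (-μ.re * s) := by
      intro s
      rw [Complex.norm_exp]
      simp
    -- The derivative of `e^{-μs} e^{sM} v` is `e^{-μs} e^{sM} (M - μ) v`, of norm at most `K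
    -- e^{cs}`; integrating this gives the boundary function `B`.
    have hbound := image_norm_le_of_norm_deriv_right_le_deriv_boundary
      (f := fun s : ℝ => Complex.exp (-μ * s) • (exp (s • M) *ᵥ v)) (a := 0) (b := t)
      (fun s _ => (hderiv s).continuousAt.continuousWithinAt)
      (fun s _ => (hderiv s).hasDerivWithinAt)
      (B := fun s => ‖v‖ + K / c * Real.exp (c * s)) (B' := fun s => K * Real.exp (c * s))
      (by
        have : 0 ≤ K / c := by positivity
        simpa using this)
      (fun s => by
        have h := (((hasDerivAt_id s).const_mul c).exp.const_mul (K / c)).const_add ‖v‖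
        refine h.congr_deriv ?_
        simp only [id, mul_one]
        field_simp)
      (fun s hs => by
        rw [norm_smul, hnorm]
        calc Real.exp (-μ.re * s) * ‖exp (s • M) *ᵥ (M *ᵥ v - μ • v)‖
            ≤ Real.exp (-μ.re * s) * (K * Real.exp (γ * s)) := by gcongr; exact hK s hs.1
          _ = K * Real.exp (c * s) := by
            rw [mul_left_comm, ← Real.exp_add, hc]; ring_nf)
    have h := hbound (Set.right_mem_Icc.2 ht)
    simp only [norm_smul, hnorm] at h
    calc ‖exp (t • M) *ᵥ v‖
        = Real.exp (μ.re * t) * (Real.exp (-μ.re * t) * ‖exp (t • M) *ᵥ v‖) := by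
          rw [← mul_assoc, ← Real.exp_add]; simp
      _ ≤ Real.exp (μ.re * t) * (‖v‖ + K / c * Real.exp (c * t)) := by gcongr
      _ = ‖v‖ * Real.exp (μ.re * t) + K / c * Real.exp (γ * t) := by
          rw [mul_add, mul_left_comm, ← Real.exp_add, hc]; ring_nf
      _ ≤ ‖v‖ * Real.exp (γ * t) + K / c * Real.exp (γ * t) := by
          gcongr; linarith
      _ = (‖v‖ + K / c) * Real.exp (γ * t) := by ring

/-- If all eigenvalues of `M` lie in the closed left half plane, then every orbit of the matrix
exponential grows slower than any exponential. -/
theorem Matrix.exists_norm_exp_smul_mulVec_le {m : Type*} [Fintype m]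
    [DecidableEq m] (M : Matrix m m ℂ)
    (hM : ∀ μ : ℂ, Module.End.HasEigenvalue (Matrix.toLin' M) μ → μ.re ≤ 0) {γ : ℝ} (hγ : 0 < γ)
    (v : m → ℂ) :
    ∃ K : ℝ, ∀ t : ℝ, 0 ≤ t → ‖exp (t • M) *ᵥ v‖ ≤ K * Real.exp (γ * t) := by
  -- The vectors with the required growth form a subspace; it contains all generalized eigenspaces,
  -- and these span over `ℂ`.
  let S : Submodule ℂ (m → ℂ) :=
    { carrier := {v | ∃ K : ℝ, ∀ t : ℝ, 0 ≤ t → ‖exp (t • M) *ᵥ v‖ ≤ K * Real.exp (γ * t)}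
      zero_mem' := ⟨0, fun t _ => by simp⟩
      add_mem' := by
        rintro v w ⟨K, hK⟩ ⟨L, hL⟩
        refine ⟨K + L, fun t ht => ?_⟩
        rw [Matrix.mulVec_add, add_mul]
        exact (norm_add_le _ _).trans (add_le_add (hK t ht) (hL t ht))
      smul_mem' := by
        rintro a v ⟨K, hK⟩
        refine ⟨‖a‖ * K, fun t ht => ?_⟩
        rw [Matrix.mulVec_smul, norm_smul, mul_assoc]
        exact mul_le_mul_of_nonneg_left (hK t ht) (norm_nonneg a) }
  have hS : S = ⊤ := by
    rw [eq_top_iff, ← Module.End.iSup_maxGenEigenspace_eq_top (Matrix.toLin' M)]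
    refine iSup_le fun μ v hv => ?_
    obtain ⟨k, hk⟩ := (Module.End.mem_maxGenEigenspace _ _ _).1 hv
    by_cases hμ : Module.End.HasEigenvalue (Matrix.toLin' M) μ
    · exact M.exists_norm_exp_smul_mulVec_le_of_pow_sub_apply_eq_zero (hM μ hμ) hγ k v hk
    · have hbot : Module.End.maxGenEigenspace (Matrix.toLin' M) μ = ⊥ := by
        by_contra hne
        exact hμ (Module.End.hasEigenvalue_of_maxGenEigenspace_ne_bot hne)
      rw [hbot] at hv
      rw [(Submodule.mem_bot ℂ).1 hv]
      exact S.zero_mem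
  have : v ∈ S := hS ▸ Submodule.mem_top
  exact this

theorem Matrix.map_ofReal_exp {m : Type*} [Fintype m] [DecidableEq m] (A : Matrix m m ℝ) :
    (exp A).map ((↑) : ℝ → ℂ) = exp (A.map ((↑) : ℝ → ℂ)) :=
  NormedSpace.map_exp (Complex.ofRealHom.mapMatrix (m := m))
    (continuous_id.matrix_map Complex.continuous_ofReal) A

end MatrixExponential

/-- Bounding the columns of the complexified exponential, one per basis vector, makes the constant
independent of `v`. -/
theorem NoEigenvalueWithPosRe.exists_norm_exp_smul_mulVec_le {n : ℕ}
    {A : Matrix (Fin n) (Fin n) ℝ} (hA : NoEigenvalueWithPosRe A) {γ : ℝ} (hγ : 0 < γ) :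
    ∃ K : ℝ, 0 ≤ K ∧ ∀ t : ℝ, 0 ≤ t → ∀ v : Fin n → ℝ,
      ‖NormedSpace.exp (t • A) *ᵥ v‖ ≤ K * Real.exp (γ * t) * ‖v‖ := by
  choose K hK using fun l : Fin n =>
    Matrix.exists_norm_exp_smul_mulVec_le (A.map ((↑) : ℝ → ℂ)) hA hγ (Pi.single l 1)
  have hK0 : ∀ l, 0 ≤ K l := fun l => by simpa using (norm_nonneg _).trans (hK l 0 le_rfl)
  have hentry : ∀ t : ℝ, 0 ≤ t → ∀ k l,
      |NormedSpace.exp (t • A) k l| ≤ K l * Real.exp (γ * t) := by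
    intro t ht k l
    refine le_trans ?_ ((norm_le_pi_norm
      (NormedSpace.exp (t • A.map ((↑) : ℝ → ℂ)) *ᵥ Pi.single l 1) k).trans (hK l t ht))
    have h : (t • A).map ((↑) : ℝ → ℂ) = t • A.map ((↑) : ℝ → ℂ) := by
      ext; simp
    rw [← h, ← Matrix.map_ofReal_exp]
    simp
  refine ⟨∑ l, K l, Finset.sum_nonneg fun l _ => hK0 l, fun t ht v => ?_⟩
  have hnn : 0 ≤ ∑ l, K l := Finset.sum_nonneg fun l _ => hK0 l
  rw [pi_norm_le_iff_of_nonneg (by positivity)]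
  intro k
  rw [Finset.sum_mul, Finset.sum_mul]
  simp only [Matrix.mulVec, dotProduct]
  refine (norm_sum_le _ _).trans (Finset.sum_le_sum fun l _ => ?_)
  rw [norm_mul]
  exact mul_le_mul (hentry t ht k l) (norm_le_pi_norm v l) (norm_nonneg _)
    (mul_nonneg (hK0 l) (Real.exp_nonneg _))

/-! ### Product rule for Carathéodory solutions. -/

section IntegrationByParts

open MeasureTheory intervalIntegral

/-- A Carathéodory solution `F` is only absolutely continuous, with derivative `h` almost
everywhere, so integration by parts for absolutely continuous functions replaces the pointwise
product rule. -/
theorem mul_eq_add_integral_of_hasDerivAt {u u' F h : ℝ → ℝ} {T : ℝ} (hT : 0 ≤ T)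
    (hu : ∀ t, HasDerivAt u (u' t) t) (hu' : Continuous u')
    (hh : IntervalIntegrable h volume 0 T)
    (hF : ∀ t ∈ Set.Icc 0 T, F t = F 0 + ∫ s in (0 : ℝ)..t, h s) :
    u T * F T = u 0 * F 0 + ∫ s in (0 : ℝ)..T, (u' s * F s + u s * h s) := by
  have hIcc : Set.uIcc 0 T = Set.Icc 0 T := Set.uIcc_of_le hT
  have h0 : (0 : ℝ) ∈ Set.uIcc 0 T := Set.left_mem_uIcc
  have hFint : AbsolutelyContinuousOnInterval (fun t => ∫ s in (0 : ℝ)..t, h s) 0 T :=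
    hh.absolutelyContinuousOnInterval_intervalIntegral h0
  have hu_ac : AbsolutelyContinuousOnInterval u 0 T := by
    have hdu : deriv u = u' := funext fun t => (hu t).deriv
    have hcd : ContDiff ℝ 1 u := contDiff_one_iff_deriv.2
      ⟨fun t => (hu t).differentiableAt, hdu ▸ hu'⟩
    obtain ⟨K, hK⟩ := hcd.contDiffOn.exists_lipschitzOnWith one_ne_zero (convex_uIcc 0 T)
      isCompact_uIcc
    exact hK.absolutelyContinuousOnInterval
  have hconst : AbsolutelyContinuousOnInterval (fun _ : ℝ => F 0) 0 T :=
    ((LipschitzWith.const (F 0)).lipschitzOnWith (s := Set.uIcc 0 T)).absolutelyContinuousOnInterval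
  have key := hu_ac.integral_deriv_mul_eq_sub (hconst.fun_add hFint)
  have hcongr : ∫ s in (0 : ℝ)..T, (u' s * F s + u s * h s) =
      ∫ s in (0 : ℝ)..T, (deriv u s * (F 0 + ∫ r in (0 : ℝ)..s, h r) +
        u s * deriv (fun s => F 0 + ∫ r in (0 : ℝ)..s, h r) s) := by
    apply intervalIntegral.integral_congr_ae
    filter_upwards [hh.ae_hasDerivAt_integral] with s hs hsT
    have hs' := Set.uIoc_subset_uIcc hsT
    rw [(hu s).deriv, ((hs hs' 0 h0).const_add (F 0)).deriv, ← hF s (hIcc ▸ hs')]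
  rw [hcongr, key, hF T (Set.right_mem_Icc.2 hT)]
  simp

theorem Matrix.mulVec_eq_add_integral_of_hasDerivAt {m : Type*} [Fintype m] [DecidableEq m]
    {V V' : ℝ → Matrix m m ℝ} {F h : ℝ → m → ℝ} {T : ℝ} (hT : 0 ≤ T)
    (hV : ∀ t, HasDerivAt V (V' t) t) (hV' : Continuous V')
    (hh : IntervalIntegrable h volume 0 T) (hFc : Continuous F)
    (hF : ∀ t ∈ Set.Icc 0 T, F t = F 0 + ∫ s in (0 : ℝ)..t, h s) :
    V T *ᵥ F T = V 0 *ᵥ F 0 + ∫ s in (0 : ℝ)..T, (V' s *ᵥ F s + V s *ᵥ h s) := by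
  have hcoord : ∀ {g : ℝ → m → ℝ} {t : ℝ}, IntervalIntegrable g volume 0 t → ∀ l,
      (∫ s in (0 : ℝ)..t, g s) l = ∫ s in (0 : ℝ)..t, g s l := fun {g t} hg l =>
    ((ContinuousLinearMap.proj (R := ℝ) (φ := fun _ : m => ℝ) l).intervalIntegral_comp_comm hg).symm
  have hhl : ∀ l, IntervalIntegrable (fun s => h s l) volume 0 T := fun l =>
    ⟨(ContinuousLinearMap.proj (R := ℝ) (φ := fun _ : m => ℝ) l).integrable_comp hh.1,
      (ContinuousLinearMap.proj (R := ℝ) (φ := fun _ : m => ℝ) l).integrable_comp hh.2⟩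
  have hFl : ∀ l, ∀ t ∈ Set.Icc 0 T, F t l = F 0 l + ∫ s in (0 : ℝ)..t, h s l := by
    intro l t ht
    rw [← hcoord (hh.mono_set (Set.uIcc_subset_uIcc_left (Set.uIcc_of_le hT ▸ ht))) l]
    exact congrFun (hF t ht) l
  have hVc : ∀ k l, Continuous fun s => V s k l := fun k l =>
    continuous_iff_continuousAt.2 fun t => ((hV t).matrix_entry k l).continuousAt
  have hterm : ∀ k l, IntervalIntegrable
      (fun s => V' s k l * F s l + V s k l * h s l) volume 0 T := fun k l =>
    (((hV'.matrix_elem k l).mul ((continuous_apply l).comp hFc)).intervalIntegrable _ _).add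
      ((hhl l).continuousOn_mul (hVc k l).continuousOn)
  have hsum : ∀ s k, (V' s *ᵥ F s + V s *ᵥ h s) k =
      ∑ l, (V' s k l * F s l + V s k l * h s l) := by
    intro s k
    simp [Matrix.mulVec, dotProduct, Finset.sum_add_distrib]
  have hint : IntervalIntegrable (fun s => V' s *ᵥ F s + V s *ᵥ h s) volume 0 T := by
    rw [intervalIntegrable_iff]
    refine Integrable.of_eval fun k => ?_
    simp_rw [hsum]
    exact integrable_finsetSum _ fun l _ => intervalIntegrable_iff.1 (hterm k l)
  ext k
  rw [Pi.add_apply, hcoord hint]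
  simp_rw [hsum]
  rw [intervalIntegral.integral_finsetSum fun l _ => hterm k l]
  simp only [Matrix.mulVec, dotProduct]
  rw [← Finset.sum_add_distrib]
  refine Finset.sum_congr rfl fun l _ => ?_
  exact mul_eq_add_integral_of_hasDerivAt hT (fun t => (hV t).matrix_entry k l)
    (hV'.matrix_elem k l) (hhl l) (hFl l)

end IntegrationByParts

/-! ### Comparison principle for delay systems. -/

section Comparison

open MeasureTheory

/-- A comparison principle for delay systems: if the weighted exponential bounds `M vᵢ e^{-β r}`
for the past of all components imply that the forcing `gᵢ` of `zᵢ' = -lᵢ zᵢ + gᵢ` is bounded by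
`M (lᵢ - β) vᵢ e^{-β s}`, then the bound of the initial history persists. -/
theorem norm_le_mul_exp_of_delay_bound {ι E : Type*} [Finite ι] [NormedAddCommGroup E]
    [NormedSpace ℝ E] {z g : ι → ℝ → E} {v l : ι → ℝ} {β K : ℝ}
    (hz : ∀ i, Continuous (z i)) (hv : ∀ i, 0 < v i)
    (hK : ∀ i, ∀ t ≤ 0, ‖z i t‖ ≤ K * v i * Real.exp (-β * t))
    (hint : ∀ i, ∀ t ≥ 0, Real.exp (l i * t) • z i t =
      z i 0 + ∫ s in (0 : ℝ)..t, Real.exp (l i * s) • g i s)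
    (hg : ∀ M, 0 ≤ M → ∀ s ≥ 0, (∀ j, ∀ r ≤ s, ‖z j r‖ ≤ M * v j * Real.exp (-β * r)) →
      ∀ i, ‖g i s‖ ≤ M * (l i - β) * v i * Real.exp (-β * s)) :
    ∀ i t, ‖z i t‖ ≤ K * v i * Real.exp (-β * t) := by
  -- Enlarging `K` makes the bound strict at time `0`. At the first time `T` when some component
  -- reaches it, variation of constants forces strict inequality, a contradiction.
  have strict : ∀ L > K, ∀ t ≥ 0, ∀ i, ‖z i t‖ < L * v i * Real.exp (-β * t) := by
    intro L hL
    by_contra! hcon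
    obtain ⟨t₁, ht₁, i₁, hi₁⟩ := hcon
    have hK0 : 0 ≤ K := by
      have h := (norm_nonneg _).trans (hK i₁ 0 le_rfl)
      simp only [mul_zero, Real.exp_zero, mul_one] at h
      exact nonneg_of_mul_nonneg_left h (hv i₁)
    let S : Set ℝ := Set.Ici 0 ∩ ⋃ i, {t | L * v i * Real.exp (-β * t) ≤ ‖z i t‖}
    have hSc : IsClosed S := isClosed_Ici.inter
      (isClosed_iUnion_of_finite fun i => isClosed_le (by fun_prop) (hz i).norm)
    have hSb : BddBelow S := ⟨0, fun t ht => ht.1⟩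
    have hT : sInf S ∈ S :=
      hSc.csInf_mem ⟨t₁, ht₁, Set.mem_iUnion.2 ⟨i₁, hi₁⟩⟩ hSb
    set T := sInf S with hTdef
    obtain ⟨hT0, hTi⟩ := hT
    obtain ⟨i, hi⟩ := Set.mem_iUnion.1 hTi
    have hT0 : 0 ≤ T := hT0
    have hi : L * v i * Real.exp (-β * T) ≤ ‖z i T‖ := hi
    have hbefore : ∀ j, ∀ r < T, ‖z j r‖ ≤ L * v j * Real.exp (-β * r) := by
      intro j r hr
      rcases le_total r 0 with hr0 | hr0
      · refine (hK j r hr0).trans ?_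
        have := (hv j).le
        gcongr
      · by_contra! hlt
        exact absurd (csInf_le hSb ⟨hr0, Set.mem_iUnion.2 ⟨j, hlt.le⟩⟩) (not_le.2 hr)
    -- The endpoint `r = T` is included because `hg` at time `s` requires the bound up to and
    -- including `s`.
    have hupto : ∀ j, ∀ r ≤ T, ‖z j r‖ ≤ L * v j * Real.exp (-β * r) := by
      intro j r hr
      have hcl : IsClosed {r | ‖z j r‖ ≤ L * v j * Real.exp (-β * r)} :=
        isClosed_le (hz j).norm (by fun_prop)
      have hsub : closure (Set.Iio T) ⊆ {r | ‖z j r‖ ≤ L * v j * Real.exp (-β * r)} :=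
        hcl.closure_subset_iff.2 fun r hr => hbefore j r hr
      rw [closure_Iio] at hsub
      exact hsub hr
    have hFTC : ∫ s in (0 : ℝ)..T, L * (l i - β) * v i * Real.exp ((l i - β) * s) =
        L * v i * Real.exp ((l i - β) * T) - L * v i := by
      rw [intervalIntegral.integral_eq_sub_of_hasDerivAt
        (f := fun s => L * v i * Real.exp ((l i - β) * s))]
      · simp
      · intro s _
        refine (((hasDerivAt_id s).const_mul (l i - β)).exp.const_mul (L * v i)).congr_deriv ?_
        simp only [id, mul_one]
        ring
      · exact Continuous.intervalIntegrable (by fun_prop) _ _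
    have hbound : ‖∫ s in (0 : ℝ)..T, Real.exp (l i * s) • g i s‖ ≤
        L * v i * Real.exp ((l i - β) * T) - L * v i := by
      rw [← hFTC]
      refine intervalIntegral.norm_integral_le_of_norm_le hT0 (Filter.Eventually.of_forall ?_)
        (Continuous.intervalIntegrable (by fun_prop) _ _)
      intro s hs
      have h := hg L (hK0.trans hL.le) s hs.1.le (fun j r hr => hupto j r (hr.trans hs.2)) i
      rw [norm_smul, Real.norm_of_nonneg (Real.exp_nonneg _)]
      calc Real.exp (l i * s) * ‖g i s‖
          ≤ Real.exp (l i * s) * (L * (l i - β) * v i * Real.exp (-β * s)) := by gcongr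
        _ = L * (l i - β) * v i * (Real.exp (l i * s) * Real.exp (-β * s)) := by ring
        _ = L * (l i - β) * v i * Real.exp ((l i - β) * s) := by
          rw [← Real.exp_add]; ring_nf
    have hz0 : ‖z i 0‖ < L * v i := by
      have := hK i 0 le_rfl
      simp only [mul_zero, Real.exp_zero, mul_one] at this
      exact this.trans_lt (mul_lt_mul_of_pos_right hL (hv i))
    have hnorm : Real.exp (l i * T) * ‖z i T‖ < L * v i * Real.exp ((l i - β) * T) := by
      rw [← Real.norm_of_nonneg (Real.exp_nonneg (l i * T)), ← norm_smul, hint i T hT0]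
      have := norm_add_le (z i 0) (∫ s in (0 : ℝ)..T, Real.exp (l i * s) • g i s)
      linarith
    have hle : L * v i * Real.exp ((l i - β) * T) ≤ Real.exp (l i * T) * ‖z i T‖ := by
      calc L * v i * Real.exp ((l i - β) * T)
          = Real.exp (l i * T) * (L * v i * Real.exp (-β * T)) := by
            rw [mul_left_comm, ← Real.exp_add]; ring_nf
        _ ≤ _ := by gcongr
    exact absurd hnorm (not_lt.2 hle)
  intro i t
  rcases le_total t 0 with ht | ht
  · exact hK i t ht
  -- Let `L` decrease to `K`.
  · refine ge_of_tendsto (x := nhdsWithin K (Set.Ioi K))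
      (f := fun L => L * v i * Real.exp (-β * t)) ?_ ?_
    · exact ((by fun_prop : Continuous fun L : ℝ => L * v i * Real.exp (-β * t)).tendsto
        K).mono_left nhdsWithin_le_nhds
    · filter_upwards [self_mem_nhdsWithin] with L hL
      exact (strict L hL t ht i).le

end Comparison

/-! ### Weights from the spanning tree, and the decay rate. -/

section Digraph

variable {N : ℕ} {G : Digraph (Fin (N + 1))}

theorem weight_nonneg (i j : Fin (N + 1)) : 0 ≤ weight G i j := by
  unfold weight; split_ifs <;> norm_num

theorem weight_le_one (i j : Fin (N + 1)) : weight G i j ≤ 1 := by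
  unfold weight; split_ifs <;> norm_num

theorem weight_of_adj {i j : Fin (N + 1)} (h : G.Adj j i) : weight G i j = 1 := if_pos h

theorem weight_of_not_adj {i j : Fin (N + 1)} (h : ¬ G.Adj j i) : weight G i j = 0 := if_neg h

/-- A rooted digraph has a depth function: every node other than the root has an in-neighbour of
smaller depth. -/
theorem HasSpanningTreeRootedAt.exists_depth {r : Fin (N + 1)}
    (hG : HasSpanningTreeRootedAt G r) :
    ∃ d : Fin (N + 1) → ℕ, d r = 0 ∧ ∀ v ≠ r, ∃ u, G.Adj u v ∧ d u < d v := by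
  -- `P k v`: some walk of length `k` leads from `r` to `v`. The depth is the least such `k`.
  let P : ℕ → Fin (N + 1) → Prop :=
    fun k => Nat.rec (fun v => v = r) (fun _ Q v => ∃ u, Q u ∧ G.Adj u v) k
  have hP : ∀ v, ∃ k, P k v := by
    intro v
    induction hG v with
    | refl => exact ⟨0, rfl⟩
    | tail _ huv ih => exact ih.elim fun k hk => ⟨k + 1, _, hk, huv⟩
  refine ⟨fun v => sInf {k | P k v}, Nat.sInf_eq_zero.2 (Or.inl rfl), fun v hv => ?_⟩
  have hspec : P (sInf {k | P k v}) v := Nat.sInf_mem (hP v)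
  show ∃ u, G.Adj u v ∧ sInf {k | P k u} < sInf {k | P k v}
  cases hk : sInf {k | P k v} with
  | zero => rw [hk] at hspec; exact absurd hspec hv
  | succ k =>
    rw [hk] at hspec
    obtain ⟨u, hu, huv⟩ := hspec
    exact ⟨u, huv, Nat.lt_succ_of_le (Nat.sInf_le hu)⟩

/-- The number of in-neighbours of follower `i`, self-loops excluded. -/
noncomputable def followerDegree (G : Digraph (Fin (N + 1))) (i : Fin N) : ℝ :=
  ∑ j ∈ Finset.univ.erase i, weight G i.succ j.succ + weight G i.succ 0

/-- The grounded Laplacian of a digraph rooted at the leader is a nonsingular M-matrix. -/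
theorem HasSpanningTreeRootedAt.exists_sum_weight_mul_lt (hG : HasSpanningTreeRootedAt G 0) :
    ∃ v : Fin N → ℝ, (∀ i, 1 / 2 ≤ v i) ∧ (∀ i, v i ≤ 1) ∧
      ∀ i, ∑ j ∈ Finset.univ.erase i, weight G i.succ j.succ * v j < followerDegree G i * v i := by
  obtain ⟨d, hd0, hd⟩ := hG.exists_depth
  set δ : ℝ := 1 / (N + 1) with hδ
  have hδ0 : 0 < δ := by positivity
  have hδ1 : δ ≤ 1 := by rw [hδ, div_le_one (by positivity)]; linarith [Nat.cast_nonneg (α := ℝ) N]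
  have hNδ : N * δ < 1 := by
    rw [hδ, mul_one_div, div_lt_one (by positivity)]; linarith
  -- For `v = 1 - δ ^ d` the claim becomes `d_i δ^{d(i)} < ∑ a_ij δ^{d(j)}`, leader included with
  -- `δ^0 = 1`. An in-neighbour `u` of smaller depth contributes `δ^{d(u)}`, while the left side is
  -- at most `N δ · δ^{d(u)}`, and `N δ < 1`.
  refine ⟨fun i => 1 - δ ^ d i.succ, fun i => ?_, fun i => ?_, fun i => ?_⟩
  · obtain ⟨u, -, hu⟩ := hd i.succ (Fin.succ_ne_zero i)
    have h1 : δ ^ d i.succ ≤ δ ^ 1 := pow_le_pow_of_le_one hδ0.le hδ1 (by omega)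
    have h2 : δ ≤ 1 / 2 := by
      rw [hδ]
      have : (1 : ℝ) ≤ N := by
        exact_mod_cast Nat.one_le_iff_ne_zero.2 (by rintro rfl; exact i.elim0)
      exact one_div_le_one_div_of_le (by norm_num) (by linarith)
    rw [pow_one] at h1
    linarith
  · have := pow_nonneg hδ0.le (d i.succ)
    linarith
  · obtain ⟨u, hui, hu⟩ := hd i.succ (Fin.succ_ne_zero i)
    have hne : u ≠ i.succ := by rintro rfl; exact hu.false
    have hdeg : followerDegree G i ≤ N := by
      have h1 : ∑ j ∈ Finset.univ.erase i, weight G i.succ j.succ ≤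
          ∑ j ∈ Finset.univ.erase i, (1 : ℝ) := Finset.sum_le_sum fun j _ => weight_le_one _ _
      have h2 : (∑ j ∈ Finset.univ.erase i, (1 : ℝ)) = N - 1 := by
        have hN : 1 ≤ N := Nat.one_le_iff_ne_zero.2 (by rintro rfl; exact i.elim0)
        simp [Finset.card_erase_of_mem, Nat.cast_sub hN]
      have h3 := weight_le_one (G := G) i.succ 0
      unfold followerDegree
      linarith
    have hlow : δ ^ d u ≤ ∑ j ∈ Finset.univ.erase i, weight G i.succ j.succ * δ ^ d j.succ +
        weight G i.succ 0 := by
      have hnn : ∀ j ∈ Finset.univ.erase i, 0 ≤ weight G i.succ j.succ * δ ^ d j.succ :=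
        fun j _ => mul_nonneg (weight_nonneg _ _) (by positivity)
      rcases Fin.eq_zero_or_eq_succ u with rfl | ⟨j, rfl⟩
      · rw [hd0, weight_of_adj hui]
        simpa using Finset.sum_nonneg hnn
      · have hj : j ∈ Finset.univ.erase i :=
          Finset.mem_erase.2 ⟨fun h => hne (h ▸ rfl), Finset.mem_univ j⟩
        have := Finset.single_le_sum hnn hj
        rw [weight_of_adj hui, one_mul] at this
        linarith [weight_nonneg (G := G) i.succ 0]
    have hup : followerDegree G i * δ ^ d i.succ < δ ^ d u := by
      calc followerDegree G i * δ ^ d i.succ ≤ N * δ ^ (d u + 1) := by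
            refine mul_le_mul hdeg (pow_le_pow_of_le_one hδ0.le hδ1 hu) (by positivity)
              (Nat.cast_nonneg N)
        _ = (N * δ) * δ ^ d u := by ring
        _ < 1 * δ ^ d u := by gcongr
        _ = δ ^ d u := one_mul _
    have hexp : ∑ j ∈ Finset.univ.erase i, weight G i.succ j.succ * (1 - δ ^ d j.succ) =
        ∑ j ∈ Finset.univ.erase i, weight G i.succ j.succ -
          ∑ j ∈ Finset.univ.erase i, weight G i.succ j.succ * δ ^ d j.succ := by
      rw [← Finset.sum_sub_distrib]
      exact Finset.sum_congr rfl fun j _ => by ring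
    rw [hexp]
    unfold followerDegree at hup ⊢
    linarith

/-- The strict diagonal dominance survives a small decay rate and the delays. -/
theorem exists_decay_rate {v : Fin N → ℝ} {ε : ℝ} (hε : 0 < ε) (τbar : ℝ)
    (hv : ∀ i, ∑ j ∈ Finset.univ.erase i, weight G i.succ j.succ * v j <
      followerDegree G i * v i) :
    ∃ β > 0, ∀ i, ε * (∑ j ∈ Finset.univ.erase i, weight G i.succ j.succ * v j) *
      Real.exp (β * τbar) ≤ (ε * followerDegree G i - β) * v i := by
  -- At `β = 0` this is `hv` times `ε`; continuity and finiteness of the index set extend it to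
  -- small `β > 0`.
  have hev : ∀ᶠ β in nhdsWithin (0 : ℝ) (Set.Ioi 0), ∀ i,
      ε * (∑ j ∈ Finset.univ.erase i, weight G i.succ j.succ * v j) * Real.exp (β * τbar) <
        (ε * followerDegree G i - β) * v i := by
    rw [Filter.eventually_all]
    intro i
    refine Filter.Eventually.filter_mono nhdsWithin_le_nhds ?_
    refine ContinuousAt.eventually_lt (by fun_prop) (by fun_prop) ?_
    simpa [mul_assoc] using mul_lt_mul_of_pos_left (hv i) hε
  obtain ⟨β, hβ, hβ0⟩ := (hev.and self_mem_nhdsWithin).exists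
  exact ⟨β, hβ0, fun i => (hβ i).le⟩

end Digraph

/-! ### Error dynamics in the moving coordinates. -/

section Observer

open MeasureTheory

variable {N n : ℕ} {A : Matrix (Fin n) (Fin n) ℝ} {G : Digraph (Fin (N + 1))} {ε : ℝ}
  {τ : Fin (N + 1) → Fin (N + 1) → ℝ → ℝ} {x₀ : ℝ → Fin n → ℝ} {ξ : Fin N → ℝ → Fin n → ℝ}

theorem HasDerivAt.matrix_mulVec {m : Type*} [Fintype m] [DecidableEq m]
    {V : ℝ → Matrix m m ℝ} {V' : Matrix m m ℝ} {x : ℝ → m → ℝ} {x' : m → ℝ} {t : ℝ}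
    (hV : HasDerivAt V V' t) (hx : HasDerivAt x x' t) :
    HasDerivAt (fun s => V s *ᵥ x s) (V' *ᵥ x t + V t *ᵥ x') t := by
  rw [hasDerivAt_pi] at hx ⊢
  intro k
  simp only [Matrix.mulVec, dotProduct, Pi.add_apply]
  rw [← Finset.sum_add_distrib]
  exact HasDerivAt.fun_sum fun l _ => (hV.matrix_entry k l).mul (hx l)

theorem Matrix.hasDerivAt_exp_neg_smul (A : Matrix (Fin n) (Fin n) ℝ) (t : ℝ) :
    HasDerivAt (fun s : ℝ => NormedSpace.exp ((-s) • A)) (-(NormedSpace.exp ((-t) • A) * A)) t := by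
  simpa using (-A).hasDerivAt_exp_smul t

open scoped Matrix.Norms.Operator in
theorem Matrix.continuous_exp_neg_smul (A : Matrix (Fin n) (Fin n) ℝ) :
    Continuous fun s : ℝ => NormedSpace.exp ((-s) • A) :=
  continuous_iff_continuousAt.2 fun t => (A.hasDerivAt_exp_neg_smul t).continuousAt

open scoped Matrix.Norms.Operator in
theorem Matrix.hasDerivAt_exp_mul_smul_exp_neg_smul (A : Matrix (Fin n) (Fin n) ℝ) (l t : ℝ) :
    HasDerivAt (fun s : ℝ => Real.exp (l * s) • NormedSpace.exp ((-s) • A))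
      (Real.exp (l * t) • (l • NormedSpace.exp ((-t) • A) - NormedSpace.exp ((-t) • A) * A)) t := by
  have h1 : HasDerivAt (fun s : ℝ => Real.exp (l * s)) (Real.exp (l * t) * l) t := by
    simpa using ((hasDerivAt_id t).const_mul l).exp
  refine (h1.smul (A.hasDerivAt_exp_neg_smul t)).congr_deriv ?_
  rw [smul_sub, smul_smul, smul_neg]
  abel

theorem IsLeaderTrajectory.exp_neg_smul_mulVec (hx : IsLeaderTrajectory A x₀) (t : ℝ) :
    NormedSpace.exp ((-t) • A) *ᵥ x₀ t = x₀ 0 := by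
  have hd : ∀ t, HasDerivAt (fun t => NormedSpace.exp ((-t) • A) *ᵥ x₀ t) 0 t := fun t => by
    refine ((A.hasDerivAt_exp_neg_smul t).matrix_mulVec (hx t)).congr_deriv ?_
    rw [Matrix.neg_mulVec, ← Matrix.mulVec_mulVec, neg_add_cancel]
  have := is_const_of_deriv_eq_zero (fun t => (hd t).differentiableAt)
    (fun t => (hd t).deriv) t 0
  simpa using this

theorem IsLeaderTrajectory.continuous (hx : IsLeaderTrajectory A x₀) : Continuous x₀ :=
  continuous_iff_continuousAt.2 fun t => (hx t).continuousAt

/-- The delay compensation is exact on leader trajectories; this is what makes the error equation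
homogeneous. -/
theorem IsLeaderTrajectory.exp_smul_mulVec_sub (hx : IsLeaderTrajectory A x₀) (r t : ℝ) :
    NormedSpace.exp (r • A) *ᵥ x₀ (t - r) = x₀ t := by
  have h1 : NormedSpace.exp (t • A) *ᵥ x₀ 0 = x₀ t := by
    rw [← hx.exp_neg_smul_mulVec t, A.exp_smul_mulVec_exp_smul_mulVec]
    simp
  rw [← h1, ← hx.exp_neg_smul_mulVec (t - r), A.exp_smul_mulVec_exp_smul_mulVec]
  congr 3
  ring

/-- The dynamics of the observer error `ξ_i - x₀`. -/
theorem IsLeaderTrajectory.observerField_sub (hx : IsLeaderTrajectory A x₀) (i : Fin N) (t : ℝ) :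
    observerField A G ε τ x₀ ξ i t - A *ᵥ x₀ t =
      A *ᵥ (ξ i t - x₀ t) - (ε * followerDegree G i) • (ξ i t - x₀ t) +
      ε • ∑ j ∈ Finset.univ.erase i, weight G i.succ j.succ •
        (NormedSpace.exp (τ i.succ j.succ t • A) *ᵥ
          (ξ j (t - τ i.succ j.succ t) - x₀ (t - τ i.succ j.succ t))) := by
  have hsum : ∑ j ∈ Finset.univ.erase i, weight G i.succ j.succ •
        (NormedSpace.exp (τ i.succ j.succ t • A) *ᵥ ξ j (t - τ i.succ j.succ t) - ξ i t) =
      ∑ j ∈ Finset.univ.erase i, weight G i.succ j.succ •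
        (NormedSpace.exp (τ i.succ j.succ t • A) *ᵥ
          (ξ j (t - τ i.succ j.succ t) - x₀ (t - τ i.succ j.succ t))) -
      (∑ j ∈ Finset.univ.erase i, weight G i.succ j.succ) • (ξ i t - x₀ t) := by
    rw [Finset.sum_smul, ← Finset.sum_sub_distrib]
    refine Finset.sum_congr rfl fun j _ => ?_
    rw [Matrix.mulVec_sub, hx.exp_smul_mulVec_sub]
    module
  unfold observerField followerDegree
  rw [hsum, hx.exp_smul_mulVec_sub, Matrix.mulVec_sub]
  module

theorem IsObserverTrajectory.error_eq_integral (hx : IsLeaderTrajectory A x₀)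
    (hξ : IsObserverTrajectory A G ε τ x₀ ξ) (i : Fin N) {t : ℝ} (ht : 0 ≤ t) :
    ξ i t - x₀ t = ξ i 0 - x₀ 0 +
      ∫ s in (0 : ℝ)..t, (observerField A G ε τ x₀ ξ i s - A *ᵥ x₀ s) := by
  have hc : Continuous fun s => A *ᵥ x₀ s := continuous_const.matrix_mulVec hx.continuous
  rw [intervalIntegral.integral_sub (hξ.integrable i t ht) (hc.intervalIntegrable _ _),
    ← hξ.eq_integral i t ht, hξ.eq_zero i 0 le_rfl,
    intervalIntegral.integral_eq_sub_of_hasDerivAt (fun s _ => hx s) (hc.intervalIntegrable _ _)]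
  abel

/-- Variation of constants for the observer error in the coordinates that move with the leader. -/
theorem IsObserverTrajectory.exp_smul_error_eq (hx : IsLeaderTrajectory A x₀)
    (hξ : IsObserverTrajectory A G ε τ x₀ ξ) (i : Fin N) {t : ℝ} (ht : 0 ≤ t) :
    Real.exp (ε * followerDegree G i * t) • (NormedSpace.exp ((-t) • A) *ᵥ (ξ i t - x₀ t)) =
      NormedSpace.exp ((-0 : ℝ) • A) *ᵥ (ξ i 0 - x₀ 0) +
      ∫ s in (0 : ℝ)..t, Real.exp (ε * followerDegree G i * s) •
        (ε • ∑ j ∈ Finset.univ.erase i, weight G i.succ j.succ •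
          (NormedSpace.exp ((-(s - τ i.succ j.succ s)) • A) *ᵥ
            (ξ j (s - τ i.succ j.succ s) - x₀ (s - τ i.succ j.succ s)))) := by
  set l := ε * followerDegree G i with hl
  have hc : Continuous fun s => A *ᵥ x₀ s := continuous_const.matrix_mulVec hx.continuous
  have hU := A.continuous_exp_neg_smul
  have key := Matrix.mulVec_eq_add_integral_of_hasDerivAt (F := fun s => ξ i s - x₀ s) ht
    (A.hasDerivAt_exp_mul_smul_exp_neg_smul l)
    ((by fun_prop : Continuous fun s : ℝ => Real.exp (l * s)).smul
      ((hU.const_smul l).sub (hU.matrix_mul continuous_const)))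
    ((hξ.integrable i t ht).sub (hc.intervalIntegrable _ _))
    ((hξ.continuous i).sub hx.continuous) (fun s hs => hξ.error_eq_integral hx i hs.1)
  rw [Matrix.smul_mulVec] at key
  rw [key]
  congr 1
  · simp
  · refine intervalIntegral.integral_congr fun s _ => ?_
    simp only [Matrix.smul_mulVec]
    rw [← smul_add]
    congr 1
    rw [hx.observerField_sub]
    -- The terms in `A` and in `l` cancel, leaving only the delayed neighbours.
    generalize ξ i s - x₀ s = η
    rw [Matrix.mulVec_add, Matrix.mulVec_sub, Matrix.mulVec_smul, Matrix.mulVec_smul,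
      Matrix.mulVec_sum, Matrix.sub_mulVec, Matrix.smul_mulVec,
      Matrix.mulVec_mulVec, ← hl]
    have : ∀ j, NormedSpace.exp ((-s) • A) *ᵥ (weight G i.succ j.succ •
        (NormedSpace.exp (τ i.succ j.succ s • A) *ᵥ
          (ξ j (s - τ i.succ j.succ s) - x₀ (s - τ i.succ j.succ s)))) =
        weight G i.succ j.succ • (NormedSpace.exp ((-(s - τ i.succ j.succ s)) • A) *ᵥ
          (ξ j (s - τ i.succ j.succ s) - x₀ (s - τ i.succ j.succ s))) := by
      intro j
      rw [Matrix.mulVec_smul, A.exp_smul_mulVec_exp_smul_mulVec]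
      congr 4
      ring
    simp_rw [this]
    abel

/-- The observer errors decay in the coordinates that move with the leader. -/
theorem IsObserverTrajectory.norm_exp_neg_smul_mulVec_error_le {τbar β : ℝ} {v : Fin N → ℝ}
    (hε : 0 < ε) (hβ : 0 < β)
    (hτ : ∀ (i : Fin N) (j : Fin (N + 1)), G.Adj j i.succ →
      ∀ t ≥ 0, 0 ≤ τ i.succ j t ∧ τ i.succ j t ≤ τbar)
    (hv : ∀ i, 1 / 2 ≤ v i)
    (hdom : ∀ i, ε * (∑ j ∈ Finset.univ.erase i, weight G i.succ j.succ * v j) *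
      Real.exp (β * τbar) ≤ (ε * followerDegree G i - β) * v i)
    (hx : IsLeaderTrajectory A x₀) (hξ : IsObserverTrajectory A G ε τ x₀ ξ) (i : Fin N) (t : ℝ) :
    ‖NormedSpace.exp ((-t) • A) *ᵥ (ξ i t - x₀ t)‖ ≤
      2 * ‖x₀ 0‖ * v i * Real.exp (-β * t) := by
  refine norm_le_mul_exp_of_delay_bound
    (z := fun i t => NormedSpace.exp ((-t) • A) *ᵥ (ξ i t - x₀ t))
    (fun i => A.continuous_exp_neg_smul.matrix_mulVec ((hξ.continuous i).sub hx.continuous))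
    (fun i => by linarith [hv i]) ?_ (fun i t ht => hξ.exp_smul_error_eq hx i ht) ?_ i t
  · intro i t ht
    -- On the history `z_i` is the constant `-x₀ 0`; the factor `2` offsets `v i ≥ 1 / 2`.
    rw [hξ.eq_zero i t ht, zero_sub, Matrix.mulVec_neg, norm_neg, hx.exp_neg_smul_mulVec]
    have h1 : 1 ≤ Real.exp (-β * t) := Real.one_le_exp (by nlinarith)
    have h2 : 1 ≤ 2 * v i := by linarith [hv i]
    calc ‖x₀ 0‖ = ‖x₀ 0‖ * 1 * 1 := by ring
      _ ≤ ‖x₀ 0‖ * (2 * v i) * Real.exp (-β * t) := by gcongr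
      _ = _ := by ring
  · intro M hM s hs hpast i
    rw [norm_smul, Real.norm_of_nonneg hε.le]
    have hterm : ∀ j ∈ Finset.univ.erase i, ‖weight G i.succ j.succ •
        (NormedSpace.exp ((-(s - τ i.succ j.succ s)) • A) *ᵥ
          (ξ j (s - τ i.succ j.succ s) - x₀ (s - τ i.succ j.succ s)))‖ ≤
        weight G i.succ j.succ * v j * (M * Real.exp (β * τbar) * Real.exp (-β * s)) := by
      intro j _
      -- The delay is controlled only along edges; elsewhere the weight vanishes.
      by_cases hadj : G.Adj j.succ i.succ
      · obtain ⟨h0, h1⟩ := hτ i j.succ hadj s hs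
        rw [weight_of_adj hadj, one_smul, one_mul]
        refine (hpast j _ (by linarith)).trans ?_
        have hvj : 0 ≤ v j := by linarith [hv j]
        calc M * v j * Real.exp (-β * (s - τ i.succ j.succ s))
            = M * v j * (Real.exp (β * τ i.succ j.succ s) * Real.exp (-β * s)) := by
              rw [← Real.exp_add]; ring_nf
          _ ≤ M * v j * (Real.exp (β * τbar) * Real.exp (-β * s)) := by gcongr
          _ = _ := by ring
      · rw [weight_of_not_adj hadj]; simp
    calc ε * ‖∑ j ∈ Finset.univ.erase i, weight G i.succ j.succ •
          (NormedSpace.exp ((-(s - τ i.succ j.succ s)) • A) *ᵥ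
            (ξ j (s - τ i.succ j.succ s) - x₀ (s - τ i.succ j.succ s)))‖
        ≤ ε * ∑ j ∈ Finset.univ.erase i, weight G i.succ j.succ * v j *
            (M * Real.exp (β * τbar) * Real.exp (-β * s)) := by
          gcongr
          exact norm_sum_le_of_le _ hterm
      _ = (ε * (∑ j ∈ Finset.univ.erase i, weight G i.succ j.succ * v j) *
            Real.exp (β * τbar)) * (M * Real.exp (-β * s)) := by
          rw [← Finset.sum_mul]; ring
      _ ≤ ((ε * followerDegree G i - β) * v i) * (M * Real.exp (-β * s)) := by
          exact mul_le_mul_of_nonneg_right (hdom i) (by positivity)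
      _ = _ := by ring

end Observer

/-! ### Return to the original coordinates and the Euclidean norm. -/

theorem lemma1 {N n : ℕ} (A : Matrix (Fin n) (Fin n) ℝ) (hA : NoEigenvalueWithPosRe A)
    (G : Digraph (Fin (N + 1))) (hG : HasSpanningTreeRootedAt G 0)
    (ε : ℝ) (hε : 0 < ε)
    (τ : Fin (N + 1) → Fin (N + 1) → ℝ → ℝ) (τbar : ℝ)
    (hτ : ∀ (i : Fin N) (j : Fin (N + 1)), G.Adj j i.succ →
      ∀ t ≥ 0, 0 ≤ τ i.succ j t ∧ τ i.succ j t ≤ τbar) :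
    ∃ C > 0, ∃ β > 0, ∀ (x₀ : ℝ → Fin n → ℝ) (ξ : Fin N → ℝ → Fin n → ℝ),
      IsLeaderTrajectory A x₀ → IsObserverTrajectory A G ε τ x₀ ξ →
        ∀ (i : Fin N), ∀ t ≥ 0,
          ‖WithLp.toLp 2 (ξ i t - x₀ t)‖ ≤ C * Real.exp (-β * t) * ‖WithLp.toLp 2 (x₀ 0)‖ := by
  obtain ⟨v, hv, hv1, hsum⟩ := hG.exists_sum_weight_mul_lt
  obtain ⟨β, hβ, hdom⟩ := exists_decay_rate hε τbar hsum
  -- Half of the decay rate is spent on the growth of `e^{At}`.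
  obtain ⟨K, hK0, hK⟩ := hA.exists_norm_exp_smul_mulVec_le (half_pos hβ)
  let e := PiLp.continuousLinearEquiv 2 ℝ (fun _ : Fin n => ℝ)
  let a := ‖(e.symm : (Fin n → ℝ) →L[ℝ] PiLp 2 (fun _ : Fin n => ℝ))‖
  let b := ‖(e : PiLp 2 (fun _ : Fin n => ℝ) →L[ℝ] (Fin n → ℝ))‖
  have ha : ∀ y : Fin n → ℝ, ‖WithLp.toLp 2 y‖ ≤ a * ‖y‖ := fun y =>
    (e.symm : (Fin n → ℝ) →L[ℝ] PiLp 2 (fun _ : Fin n => ℝ)).le_opNorm y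
  have hb : ∀ y : Fin n → ℝ, ‖y‖ ≤ b * ‖WithLp.toLp 2 y‖ := fun y =>
    (e : PiLp 2 (fun _ : Fin n => ℝ) →L[ℝ] (Fin n → ℝ)).le_opNorm (WithLp.toLp 2 y)
  have ha0 : 0 ≤ a := norm_nonneg _
  have hb0 : 0 ≤ b := norm_nonneg _
  -- `a` and `b` convert between the sup and Euclidean norms; the `+ 1` only ensures that `C` is
  -- positive.
  refine ⟨a * (2 * K) * b + 1, by positivity, β / 2, half_pos hβ, fun x₀ ξ hx hξ i t ht => ?_⟩
  have hz := hξ.norm_exp_neg_smul_mulVec_error_le hε hβ hτ hv hdom hx i t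
  have heq : ξ i t - x₀ t =
      NormedSpace.exp (t • A) *ᵥ (NormedSpace.exp ((-t) • A) *ᵥ (ξ i t - x₀ t)) := by
    rw [A.exp_smul_mulVec_exp_smul_mulVec]; simp
  have hsup : ‖ξ i t - x₀ t‖ ≤ 2 * K * Real.exp (-(β / 2) * t) * ‖x₀ 0‖ := by
    calc ‖ξ i t - x₀ t‖
        ≤ K * Real.exp (β / 2 * t) * ‖NormedSpace.exp ((-t) • A) *ᵥ (ξ i t - x₀ t)‖ := by
          conv_lhs => rw [heq]
          exact hK t ht _
      _ ≤ K * Real.exp (β / 2 * t) * (2 * ‖x₀ 0‖ * 1 * Real.exp (-β * t)) := by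
          gcongr
          refine hz.trans ?_
          gcongr
          exact hv1 i
      _ = 2 * K * (Real.exp (β / 2 * t) * Real.exp (-β * t)) * ‖x₀ 0‖ := by ring
      _ = _ := by rw [← Real.exp_add]; ring_nf
  calc ‖WithLp.toLp 2 (ξ i t - x₀ t)‖
      ≤ a * (2 * K * Real.exp (-(β / 2) * t) * (b * ‖WithLp.toLp 2 (x₀ 0)‖)) := by
        refine (ha _).trans (mul_le_mul_of_nonneg_left (hsup.trans ?_) ha0)
        gcongr
        exact hb _
    _ = (a * (2 * K) * b) * Real.exp (-(β / 2) * t) * ‖WithLp.toLp 2 (x₀ 0)‖ := by ring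
    _ ≤ _ := by
        gcongr
        linarith
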